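/- A \emph{weight} is a continuous, non-increasing function $v:[0,\infty)\to(0,\infty)$ with $\lim_{t\to\infty}t^kv(t)=0$ for all $k\ge 0$. It is \emph{normalized} if $v(t)=1$ for all $t\in[0,1]$, and \emph{convex} if $t\mapsto-\log v(e^t)$ is convex on $\mathbb{R}$. Let $H^\infty_v$ be the space of entire functions $f$ with $\|f\|_v:=\sup_{z\in\mathbb{C}}|f(z)|v(|z|)<\infty$, normed by $\|\cdot\|_v$. For a normalized weight $v$ and $c>0$ put $v^c(t):=v(t)^c$, and let $$H^\infty_{\underline{\mathcal V}^{\mathfrak c}}:=\varinjlim_{c\in\mathbb{N}_{>0}}H^\infty_{v^c},\qquad H^\infty_{\overline{\mathcal V}^{\mathfrak c}}:=\varprojlim_{c\in\mathbb{N}_{>0}}H^\infty_{v^{1/c}}$$ be the (LB)-space $\bigcup_c H^\infty_{v^c}$ with the locally convex inductive limit topology and the Fréchet space $\bigcap_c H^\infty_{v^{1/c}}$ with the projective limit topology. For functions $v,w:[0,\infty)\to(0,\infty)$ write $v\preceq^{\mathfrak c}w$ if there is $c\ge1$ with $w(t)^c=O(v(t))$ as $t\to+\infty$, and $v\sim^{\mathfrak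 c}w$ if $v\preceq^{\mathfrak c}w$ and $w\preceq^{\mathfrak c}v$. Finally put $M^v_j:=\sup_{t>0}t^jv(t)$ for $j\in\mathbb{N}=\{0,1,2,\dots\}$, and $v_M(t):=\exp(-\omega_M(t))$, where $\omega_M(t):=\sup_{j\in\mathbb{N}}\log(t^j/M_j)$ for $t>0$ and $\omega_M(0):=0$. \textbf{Theorem.} Let $u$ and $w$ be normalized weights and assume that $u$ is convex. Then the following are equivalent: \begin{itemize} \item[(i)] $u\preceq^{\mathfrak c}w$. \item[(ii)] $H^\infty_{\underline{\mathcal U}^{\mathfrak c}}\subseteq H^\infty_{\underline{\mathcal W}^{\mathfrak c}}$ with continuous inclusion. \item[(iii)] $H^\infty_{\overline{\mathcal U}^{\mathfrak c}}\subseteq H^\infty_{\overline{\mathcal W}^{\mathfrak c}}$ with continuous inclusion. \end{itemize} If both $u$ and $w$ are convex, then (i)--(iii) are also equivalent to each of \begin{itemize} \item[(iv)] There are $c\in\mathbb{N}_{>0}$ and $A\ge1$ such that $M^w_j\le A\,(M^u_{cj})^{1/c}$ for all $j\in\mathbb{N}$. \item[(v)] $v_{M^u}\preceq^{\mathfrak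 c}v_{M^w}$. \end{itemize} Moreover, if both $u$ and $w$ are convex, then the following are equivalent: $u\sim^{\mathfrak c}w$; $H^\infty_{\underline{\mathcal U}^{\mathfrak c}}=H^\infty_{\underline{\mathcal W}^{\mathfrak c}}$ as locally convex spaces; $H^\infty_{\overline{\mathcal U}^{\mathfrak c}}=H^\infty_{\overline{\mathcal W}^{\mathfrak c}}$ as locally convex spaces. -/

import Mathlib

open scoped NNReal Topology

/-- A weight function: a strictly positive, continuous, non-increasing and rapidly decreasing
function on `[0, ∞)`. -/
structure Weight where
  toFun : ℝ≥0 → ℝ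
  pos' : ∀ t, 0 < toFun t
  continuous' : Continuous toFun
  antitone' : Antitone toFun
  rapid' : ∀ k : ℝ, 0 ≤ k →
    Filter.Tendsto (fun t : ℝ≥0 => (t : ℝ) ^ k * toFun t) Filter.atTop (𝓝 0)

namespace Weight

instance : CoeFun Weight (fun _ => ℝ≥0 → ℝ) := ⟨Weight.toFun⟩

/-- `v(t) = 1` on `[0, 1]`. -/
def IsNormalized (v : Weight) : Prop := ∀ t : ℝ≥0, t ≤ 1 → v t = 1

/-- `t ↦ -log v(e^t)` is convex on `ℝ`. -/
def IsConvex (v : Weight) : Prop :=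
  ConvexOn ℝ Set.univ (fun t : ℝ => -Real.log (v ⟨Real.exp t, (Real.exp_pos t).le⟩))

/-- The weight `t ↦ v(t)^c`, for `c > 0`. -/
noncomputable def rpow (v : Weight) (c : ℝ) (hc : 0 < c) : Weight where
  toFun t := v t ^ c
  pos' t := Real.rpow_pos_of_pos (v.pos' t) c
  continuous' := v.continuous'.rpow_const fun t => Or.inl (v.pos' t).ne'
  antitone' s t h := Real.rpow_le_rpow (v.pos' t).le (v.antitone' h) hc.le
  rapid' k hk := by
    have h := (v.rapid' (k / c) (div_nonneg hk hc.le)).rpow_const (p := c) (Or.inr hc.le)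
    rw [Real.zero_rpow hc.ne'] at h
    refine h.congr fun t => ?_
    rw [Real.mul_rpow (Real.rpow_nonneg t.coe_nonneg _) (v.pos' t).le,
      ← Real.rpow_mul t.coe_nonneg, div_mul_cancel₀ _ hc.ne']

/-- The system `(v^c)` for `c = 1, 2, …` -/
noncomputable def expSystemLB (v : Weight) : ℕ+ → Weight :=
  fun c => v.rpow (c : ℝ) (Nat.cast_pos.2 c.pos)

/-- The system `(v^(1/c))` for `c = 1, 2, …` -/
noncomputable def expSystemFrechet (v : Weight) : ℕ+ → Weight :=
  fun c => v.rpow (1 / (c : ℝ)) (one_div_pos.2 (Nat.cast_pos.2 c.pos))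

theorem rpow_le_rpow_of_isNormalized {v : Weight} (hv : v.IsNormalized) {c d : ℝ} (hc : 0 < c)
    (hd : 0 < d) (h : c ≤ d) (t : ℝ≥0) : v.rpow d hd t ≤ v.rpow c hc t := by
  refine Real.rpow_le_rpow_of_exponent_ge (v.pos' t) ?_ h
  exact (v.antitone' (zero_le (a := t))).trans (hv 0 zero_le_one).le

/-- The associated weight sequence `M^v_j = sup_{t > 0} t^j v(t)`. -/
noncomputable def assocSeq (v : Weight) (j : ℕ) : ℝ :=
  ⨆ t : Set.Ioi (0 : ℝ≥0), ((t : ℝ≥0) : ℝ) ^ j * v t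

/-- The supremum defining `assocSeq` is finite. -/
theorem bddAbove_assocSeq (v : Weight) (j : ℕ) :
    BddAbove (Set.range fun t : Set.Ioi (0 : ℝ≥0) => ((t : ℝ≥0) : ℝ) ^ j * v t) := by
  have h := v.rapid' j j.cast_nonneg
  simp only [Real.rpow_natCast] at h
  obtain ⟨R, hR⟩ := Filter.eventually_atTop.1 (h.eventually (gt_mem_nhds zero_lt_one))
  refine ⟨max 1 ((R : ℝ) ^ j * v 0), ?_⟩
  rintro _ ⟨t, rfl⟩
  rcases le_total R (t : ℝ≥0) with ht | ht
  · exact (hR _ ht).le.trans (le_max_left _ _)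
  · refine le_trans ?_ (le_max_right _ _)
    exact mul_le_mul (pow_le_pow_left₀ (t : ℝ≥0).coe_nonneg (by exact_mod_cast ht) _)
      (v.antitone' zero_le) (v.pos' _).le (pow_nonneg R.coe_nonneg _)

end Weight

/-- The relation `v ≼^c w`: there is `c ≥ 1` with `w(t)^c = O(v(t))` as `t → +∞`. -/
def PowPrec (v w : ℝ≥0 → ℝ) : Prop :=
  ∃ c : ℝ, 1 ≤ c ∧ (fun t => w t ^ c) =O[Filter.atTop] v

/-- The relation `v ∼^c w`. -/
def PowEquiv (v w : ℝ≥0 → ℝ) : Prop := PowPrec v w ∧ PowPrec w v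

/-- The associated weight function `ω_M(t) = sup_j log (t^j / M_j)` for `t > 0`, `ω_M(0) = 0`.
It is used for positive `M` with `M_0 = 1` and `(M_j)^{1/j} → ∞`, where the supremum is finite. -/
noncomputable def assocFun (M : ℕ → ℝ) (t : ℝ≥0) : ℝ :=
  if t = 0 then 0 else ⨆ j : ℕ, Real.log ((t : ℝ) ^ j / M j)

/-- The weight `v_M(t) = exp (-ω_M(t))`. -/
noncomputable def seqWeight (M : ℕ → ℝ) (t : ℝ≥0) : ℝ := Real.exp (-assocFun M t)

namespace Weight

/-- For `M = M^v` the supremum defining `ω_M(t)` is finite: it is at most `-log v(t)`. -/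
theorem bddAbove_assocFun (v : Weight) {t : ℝ≥0} (ht : 0 < t) :
    BddAbove (Set.range fun j : ℕ => Real.log ((t : ℝ) ^ j / v.assocSeq j)) := by
  refine ⟨-Real.log (v t), ?_⟩
  rintro _ ⟨j, rfl⟩
  have hle : (t : ℝ) ^ j * v t ≤ v.assocSeq j :=
    le_ciSup (v.bddAbove_assocSeq j) (⟨t, ht⟩ : Set.Ioi (0 : ℝ≥0))
  have htj : 0 < (t : ℝ) ^ j := pow_pos (NNReal.coe_pos.2 ht) _
  have hM : 0 < v.assocSeq j := (mul_pos htj (v.pos' t)).trans_le hle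
  rw [← Real.log_inv]
  refine Real.log_le_log (div_pos htj hM) ?_
  rw [div_le_iff₀ hM, inv_mul_eq_div, le_div_iff₀ (v.pos' t)]
  exact hle

end Weight

/-- The entire functions `f` with `sup_z |f(z)| v(|z|) < ∞`. -/
def hInfSubmodule (v : Weight) : Submodule ℂ (ℂ → ℂ) where
  carrier := {f | Differentiable ℂ f ∧ BddAbove (Set.range fun z : ℂ => ‖f z‖ * v ‖z‖₊)}
  zero_mem' := ⟨differentiable_const 0, 0, by rintro _ ⟨z, rfl⟩; simp⟩
  add_mem' := by
    rintro f g ⟨hf, C, hC⟩ ⟨hg, D, hD⟩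
    refine ⟨hf.add hg, C + D, ?_⟩
    rintro _ ⟨z, rfl⟩
    have h1 := hC ⟨z, rfl⟩
    have h2 := hD ⟨z, rfl⟩
    have h3 := mul_le_mul_of_nonneg_right (norm_add_le (f z) (g z)) (v.pos' ‖z‖₊).le
    simp only [Pi.add_apply] at *
    linarith
  smul_mem' := by
    rintro a f ⟨hf, C, hC⟩
    refine ⟨hf.const_smul a, ‖a‖ * C, ?_⟩
    rintro _ ⟨z, rfl⟩
    have h1 := mul_le_mul_of_nonneg_left (hC ⟨z, rfl⟩) (norm_nonneg a)
    simpa [mul_assoc] using h1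

/-- The space `H^∞_v`; its norm is `sup_z |f(z)| v(|z|)`. -/
def HInf (v : Weight) : Type := hInfSubmodule v

namespace HInf

variable {v : Weight}

noncomputable instance : AddCommGroup (HInf v) := inferInstanceAs (AddCommGroup (hInfSubmodule v))

noncomputable instance : Module ℂ (HInf v) := inferInstanceAs (Module ℂ (hInfSubmodule v))

instance : FunLike (HInf v) ℂ ℂ := ⟨fun f => f.1, fun _ _ h => Subtype.ext h⟩

noncomputable instance : Norm (HInf v) := ⟨fun f => ⨆ z : ℂ, ‖f z‖ * v ‖z‖₊⟩

theorem norm_def (f : HInf v) : ‖f‖ = ⨆ z : ℂ, ‖f z‖ * v ‖z‖₊ := rfl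

theorem le_norm (f : HInf v) (z : ℂ) : ‖f z‖ * v ‖z‖₊ ≤ ‖f‖ := le_ciSup f.2.2 z

theorem normedSpaceCore : NormedSpace.Core ℂ (HInf v) where
  norm_nonneg f := Real.iSup_nonneg fun z => mul_nonneg (norm_nonneg _) (v.pos' _).le
  norm_smul a f := by
    rw [norm_def, norm_def, Real.mul_iSup_of_nonneg (norm_nonneg a)]
    refine iSup_congr fun z => ?_
    have : (a • f) z = a * f z := rfl
    rw [this, norm_mul, mul_assoc]
  norm_triangle f g := by
    refine ciSup_le fun z => ?_
    have h : (f + g) z = f z + g z := rfl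
    have h3 := mul_le_mul_of_nonneg_right (norm_add_le (f z) (g z)) (v.pos' ‖z‖₊).le
    rw [h]
    linarith [le_norm f z, le_norm g z]
  norm_eq_zero_iff f := by
    constructor
    · intro h
      refine DFunLike.ext _ _ fun z => ?_
      have h1 := le_norm f z
      have h2 : ‖f z‖ = 0 := le_antisymm
        (le_of_mul_le_mul_right (by rw [zero_mul, ← h]; exact h1) (v.pos' ‖z‖₊)) (norm_nonneg _)
      exact norm_eq_zero.1 h2
    · rintro rfl
      have h : ∀ z : ℂ, (0 : HInf v) z = 0 := fun _ => rfl
      simp [norm_def, h]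

noncomputable instance : NormedAddCommGroup (HInf v) := NormedAddCommGroup.ofCore normedSpaceCore

noncomputable instance : NormedSpace ℂ (HInf v) := NormedSpace.ofCore normedSpaceCore

end HInf

/-- The inductive limit of the spaces `H^∞_{v_n}`, as a vector space: the union of these spaces,
when `(v_n)` is non-increasing. -/
def indSubmodule (V : ℕ+ → Weight) : Submodule ℂ (ℂ → ℂ) := ⨆ n, hInfSubmodule (V n)

/-- The projective limit of the spaces `H^∞_{v_n}`, as a vector space: their intersection. -/
def projSubmodule (V : ℕ+ → Weight) : Submodule ℂ (ℂ → ℂ) := ⨅ n, hInfSubmodule (V n)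

theorem mem_indSubmodule_iff {V : ℕ+ → Weight} (hV : ∀ m n, m ≤ n → ∀ t, V n t ≤ V m t)
    {f : ℂ → ℂ} : f ∈ indSubmodule V ↔ ∃ n, f ∈ hInfSubmodule (V n) := by
  have hmono : Monotone fun n => hInfSubmodule (V n) := by
    rintro m n h f ⟨hf, C, hC⟩
    refine ⟨hf, C, ?_⟩
    rintro _ ⟨z, rfl⟩
    exact (mul_le_mul_of_nonneg_left (hV m n h _) (norm_nonneg _)).trans (hC ⟨z, rfl⟩)
  exact Submodule.mem_iSup_of_directed _ hmono.directed_le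

theorem mem_projSubmodule_iff {V : ℕ+ → Weight} {f : ℂ → ℂ} :
    f ∈ projSubmodule V ↔ ∀ n, f ∈ hInfSubmodule (V n) := Submodule.mem_iInf _

/-- The locally convex inductive limit of the spaces `H^∞_{v_n}`, for `(v_n)` non-increasing. -/
def HInd (V : ℕ+ → Weight) : Type := indSubmodule V

namespace HInd

variable {V : ℕ+ → Weight}

noncomputable instance : AddCommGroup (HInd V) := inferInstanceAs (AddCommGroup (indSubmodule V))

noncomputable instance : Module ℂ (HInd V) := inferInstanceAs (Module ℂ (indSubmodule V))

instance : FunLike (HInd V) ℂ ℂ := ⟨fun f => f.1, fun _ _ h => Subtype.ext h⟩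

/-- The inclusion `H^∞_{v_n} → HInd V`. -/
def incl (n : ℕ+) (f : HInf (V n)) : HInd V :=
  ⟨f.1, le_iSup (fun m => hInfSubmodule (V m)) n f.2⟩

/-- The finest locally convex vector space topology that makes all inclusions
`H^∞_{v_n} → HInd V` continuous. (In Mathlib's order on topologies, finer means smaller.) -/
noncomputable instance : TopologicalSpace (HInd V) :=
  sInf {t : TopologicalSpace (HInd V) |
    (∀ n, @Continuous (HInf (V n)) (HInd V) _ t (incl n)) ∧
    @IsTopologicalAddGroup (HInd V) t _ ∧
    @ContinuousSMul ℂ (HInd V) _ _ t ∧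
    @LocallyConvexSpace ℝ (HInd V) _ _ _ _ t}

end HInd

/-- The projective limit of the spaces `H^∞_{v_n}`, for `(v_n)` non-decreasing. -/
def HProj (V : ℕ+ → Weight) : Type := projSubmodule V

namespace HProj

variable {V : ℕ+ → Weight}

noncomputable instance : AddCommGroup (HProj V) := inferInstanceAs (AddCommGroup (projSubmodule V))

noncomputable instance : Module ℂ (HProj V) := inferInstanceAs (Module ℂ (projSubmodule V))

instance : FunLike (HProj V) ℂ ℂ := ⟨fun f => f.1, fun _ _ h => Subtype.ext h⟩

/-- The inclusion `HProj V → H^∞_{v_n}`. -/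
def proj (n : ℕ+) (f : HProj V) : HInf (V n) :=
  ⟨f.1, iInf_le (fun m => hInfSubmodule (V m)) n f.2⟩

/-- The coarsest topology that makes all inclusions `HProj V → H^∞_{v_n}` continuous. -/
noncomputable instance : TopologicalSpace (HProj V) :=
  ⨅ n, TopologicalSpace.induced (proj n) inferInstance

end HProj

/-- `E ⊆ F` with continuous inclusion, for topological vector spaces of functions `ℂ → ℂ`. -/
def ContinuouslyIncluded (E F : Type) [AddCommGroup E] [Module ℂ E] [TopologicalSpace E]
    [FunLike E ℂ ℂ] [AddCommGroup F] [Module ℂ F] [TopologicalSpace F] [FunLike F ℂ ℂ] : Prop :=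
  ∃ ι : E →L[ℂ] F, ∀ (f : E) (z : ℂ), ι f z = f z

/-- `E = F` as topological vector spaces, for topological vector spaces of functions `ℂ → ℂ`. -/
def EqualAsTVS (E F : Type) [AddCommGroup E] [Module ℂ E] [TopologicalSpace E]
    [FunLike E ℂ ℂ] [AddCommGroup F] [Module ℂ F] [TopologicalSpace F] [FunLike F ℂ ℂ] : Prop :=
  ∃ e : E ≃L[ℂ] F, ∀ (f : E) (z : ℂ), e f z = f z

/-! Everything reduces to comparing `w` with the moments `M^u_j`. Convexity of `-log u(e^x)`
provides a supporting line at each `log t`; if its slope is `s`, then `r^s u(r)` is largest at `r =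
t`. Rounding `s` down to a multiple of `n` recovers `u(t)` from some moment `M^u_{nj}` up to a
factor `t^n` (`IsConvex.exists_assocSeq_le`). Since `w` decays faster than every power, one more
factor `w(t)` absorbs that polynomial. Hence (i) follows from `t^{nj} w(t)^c ≤ C M^u_{nj}` for all
`j` and `t ≥ 1` (`IsConvex.powPrec_of_pow_mul_le`).

Inclusions of function spaces give such bounds when tested on monomials, whose weighted norms are
moments. For Fréchet spaces, continuity is a norm estimate that yields (iv) directly. For inductive
limits, inclusion as sets suffices: otherwise a gliding hump series with nonnegative coefficients
lies in `H^∞_u` but in no `H^∞_{w^n}` (`exists_pow_mul_le_of_hInfSubmodule_subset`). Conversely, (i)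
compares the two weight systems step by step. For (v), a convex normalized weight satisfies `v(t) ≤
v_{M^v}(t) ≤ t v(t)` for `t ≥ 1`. -/

namespace Weight

variable {u v w : Weight}

/-! ### Moments, convexity and the relation `≼^c` -/

theorem IsNormalized.le_one (hv : v.IsNormalized) (t : ℝ≥0) : v t ≤ 1 :=
  (v.antitone' (zero_le (a := t))).trans (hv 0 zero_le_one).le

theorem pow_mul_le_assocSeq (v : Weight) (j : ℕ) {t : ℝ≥0} (ht : 0 < t) :
    (t : ℝ) ^ j * v t ≤ v.assocSeq j :=
  le_ciSup (v.bddAbove_assocSeq j) (⟨t, ht⟩ : Set.Ioi (0 : ℝ≥0))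

theorem assocSeq_le (v : Weight) (j : ℕ) {C : ℝ} (h : ∀ t : ℝ≥0, 0 < t → (t : ℝ) ^ j * v t ≤ C) :
    v.assocSeq j ≤ C :=
  haveI : Nonempty (Set.Ioi (0 : ℝ≥0)) := ⟨⟨1, Set.mem_Ioi.2 zero_lt_one⟩⟩
  ciSup_le fun t => h t t.2

theorem assocSeq_pos (v : Weight) (j : ℕ) : 0 < v.assocSeq j :=
  lt_of_lt_of_le (by simpa using v.pos' 1) (v.pow_mul_le_assocSeq j zero_lt_one)

/-- A weight `u` with `-log u(e^t)` convex lies below a power of `r` touching it at `t`. -/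
theorem IsConvex.exists_rpow_mul_le (hu : u.IsConvex) {t : ℝ≥0} (ht : 0 < t) :
    ∃ s : ℝ, 0 ≤ s ∧ ∀ r : ℝ≥0, 0 < r → (r : ℝ) ^ s * u r ≤ (t : ℝ) ^ s * u t := by
  set φ : ℝ → ℝ := fun x => -Real.log (u ⟨Real.exp x, (Real.exp_pos x).le⟩) with hφ
  have hφlog : ∀ r : ℝ≥0, 0 < r → φ (Real.log r) = -Real.log (u r) := fun r hr => by
    have : (⟨Real.exp (Real.log r), (Real.exp_pos _).le⟩ : ℝ≥0) = r :=
      NNReal.eq (Real.exp_log (NNReal.coe_pos.2 hr))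
    simp only [hφ, this]
  have hmono : Monotone φ := fun x y hxy => by
    refine neg_le_neg (Real.log_le_log (u.pos' _) (u.antitone' ?_))
    exact Real.exp_le_exp.2 hxy
  have hconv : ConvexOn ℝ Set.univ φ := hu
  set y := Real.log t with hy
  -- The right derivative is a subgradient at `y`: left slopes stay below it and right slopes above
  -- it.
  set s := derivWithin φ (Set.Ioi y) y with hs
  have hint : ∀ x : ℝ, x ∈ interior (Set.univ : Set ℝ) := fun x => by simp
  have hsub : ∀ x, φ y + s * (x - y) ≤ φ x := by
    intro x
    rcases lt_trichotomy x y with h | h | h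
    · have h1 := (hconv.slope_le_leftDeriv_of_mem_interior (Set.mem_univ x) (hint y) h).trans
        (hconv.leftDeriv_le_rightDeriv_of_mem_interior (hint y))
      rw [slope_def_field, div_le_iff₀ (sub_pos.2 h)] at h1
      linarith
    · simp [h]
    · have h1 := hconv.rightDeriv_le_slope_of_mem_interior (hint y) (Set.mem_univ x) h
      rw [slope_def_field, le_div_iff₀ (sub_pos.2 h)] at h1
      linarith
  refine ⟨s, ?_, fun r hr => ?_⟩
  · have h1 := hsub (y - 1)
    have h2 : φ (y - 1) ≤ φ y := hmono (by linarith)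
    linarith
  · have h1 := hsub (Real.log r)
    rw [hφlog r hr, hy, hφlog t ht] at h1
    have hr' : 0 < (r : ℝ) := NNReal.coe_pos.2 hr
    have ht' : 0 < (t : ℝ) := NNReal.coe_pos.2 ht
    rw [← Real.log_le_log_iff (mul_pos (Real.rpow_pos_of_pos hr' _) (u.pos' _))
      (mul_pos (Real.rpow_pos_of_pos ht' _) (u.pos' _)),
      Real.log_mul (Real.rpow_pos_of_pos hr' _).ne' (u.pos' _).ne',
      Real.log_mul (Real.rpow_pos_of_pos ht' _).ne' (u.pos' _).ne',
      Real.log_rpow hr', Real.log_rpow ht']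
    linarith

/-- For a convex weight, `u(t)` is recovered up to a factor `t^n` from the moments `M^u_{nj}`. -/
theorem IsConvex.exists_assocSeq_le (hu : u.IsConvex) (hun : u.IsNormalized) {n : ℕ} (hn : 0 < n)
    {t : ℝ≥0} (ht : 1 ≤ t) :
    ∃ j : ℕ, u.assocSeq (n * j) ≤ (t : ℝ) ^ (n * j + n) * u t := by
  have ht0 : 0 < t := zero_lt_one.trans_le ht
  obtain ⟨s, hs, h⟩ := hu.exists_rpow_mul_le ht0
  have hn' : (0 : ℝ) < n := Nat.cast_pos.2 hn
  have hj1 : ((n * ⌊s / n⌋₊ : ℕ) : ℝ) ≤ s := by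
    have := Nat.floor_le (div_nonneg hs hn'.le)
    rw [le_div_iff₀ hn'] at this
    push_cast
    linarith
  have hj2 : s ≤ ((n * ⌊s / n⌋₊ + n : ℕ) : ℝ) := by
    have := (Nat.lt_floor_add_one (s / n)).le
    rw [div_le_iff₀ hn'] at this
    push_cast
    linarith
  -- With `k = n⌊s/n⌋` one has `k ≤ s ≤ k + n`: the first bound is used at `r ≥ 1`, the second at `t
  -- ≥ 1`.
  refine ⟨⌊s / n⌋₊, u.assocSeq_le _ fun r hr => ?_⟩
  set k := n * ⌊s / n⌋₊
  have key : ∀ r : ℝ≥0, 1 ≤ r → (r : ℝ) ^ k * u r ≤ (t : ℝ) ^ (k + n) * u t := by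
    intro r hr
    rw [← Real.rpow_natCast, ← Real.rpow_natCast]
    calc (r : ℝ) ^ (k : ℝ) * u r ≤ (r : ℝ) ^ s * u r :=
          mul_le_mul_of_nonneg_right (Real.rpow_le_rpow_of_exponent_le (by exact_mod_cast hr) hj1)
            (u.pos' r).le
      _ ≤ (t : ℝ) ^ s * u t := h r (zero_lt_one.trans_le hr)
      _ ≤ _ := mul_le_mul_of_nonneg_right
          (Real.rpow_le_rpow_of_exponent_le (by exact_mod_cast ht) hj2) (u.pos' t).le
  rcases le_total 1 r with hr1 | hr1
  · exact key r hr1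
  -- On `(0, 1]` normalization gives `r^k u(r) ≤ 1 = 1^k u(1)`, so the case `r = 1` suffices.
  · refine le_trans ?_ (key 1 le_rfl)
    rw [hun 1 le_rfl, NNReal.coe_one, one_pow, mul_one]
    exact mul_le_one₀ (pow_le_one₀ r.coe_nonneg (by exact_mod_cast hr1)) (u.pos' r).le
      (hun.le_one r)

/-- For normalized weights the relation `≼^c` holds on all of `[0, ∞)` with a natural exponent. -/
theorem powPrec_iff_exists_nat (hw : w.IsNormalized) :
    PowPrec u w ↔ ∃ n : ℕ, 0 < n ∧ ∃ A : ℝ, 1 ≤ A ∧ ∀ t, w t ^ n ≤ A * u t := by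
  constructor
  · rintro ⟨c, hc, h⟩
    obtain ⟨C, hC⟩ := h.bound
    obtain ⟨R, hR⟩ := Filter.eventually_atTop.1 hC
    -- `C` serves on `[R, ∞)`; on `[0, R]` one has `w ≤ 1` and `u ≥ u(R)`, so `u(R)⁻¹` serves there.
    refine ⟨⌈c⌉₊, Nat.ceil_pos.2 (by linarith), max 1 (max C (u R)⁻¹), le_max_left _ _,
      fun t => ?_⟩
    have hut := u.pos' t
    rcases le_total R t with ht | ht
    · have h1 := hR t ht
      rw [Real.norm_of_nonneg (Real.rpow_nonneg (w.pos' t).le _), Real.norm_of_nonneg hut.le] at h1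
      calc w t ^ ⌈c⌉₊ = w t ^ ((⌈c⌉₊ : ℕ) : ℝ) := (Real.rpow_natCast _ _).symm
        _ ≤ w t ^ c := Real.rpow_le_rpow_of_exponent_ge (w.pos' t) (hw.le_one t) (Nat.le_ceil c)
        _ ≤ C * u t := h1
        _ ≤ _ := by gcongr; exact (le_max_left _ _).trans (le_max_right _ _)
    · calc w t ^ ⌈c⌉₊ ≤ 1 := pow_le_one₀ (w.pos' t).le (hw.le_one t)
        _ = (u R)⁻¹ * u R := (inv_mul_cancel₀ (u.pos' R).ne').symm
        _ ≤ (u R)⁻¹ * u t :=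
          mul_le_mul_of_nonneg_left (u.antitone' ht) (inv_nonneg.2 (u.pos' R).le)
        _ ≤ _ := by gcongr; exact (le_max_right _ _).trans (le_max_right _ _)
  · rintro ⟨n, hn, A, -, h⟩
    refine ⟨n, by exact_mod_cast hn, .of_bound A (.of_forall fun t => ?_)⟩
    rw [Real.rpow_natCast, Real.norm_of_nonneg (pow_nonneg (w.pos' t).le _),
      Real.norm_of_nonneg (u.pos' t).le]
    exact h t

/-- A polynomial factor is absorbed by raising the exponent. -/
theorem powPrec_of_le_pow_mul {n c : ℕ} {C : ℝ} (hC : 0 ≤ C)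
    (h : ∀ᶠ t : ℝ≥0 in Filter.atTop, w t ^ c ≤ C * ((t : ℝ) ^ n * u t)) : PowPrec u w := by
  -- The extra factor `w(t)` turns `t^n` into the bounded quantity `t^n w(t) ≤ M^w_n`.
  refine ⟨(c + 1 : ℕ), by push_cast; linarith [c.cast_nonneg (α := ℝ)],
    .of_bound (C * w.assocSeq n) ?_⟩
  filter_upwards [h, Filter.eventually_ge_atTop 1] with t ht ht1
  have h1 := w.pow_mul_le_assocSeq n (zero_lt_one.trans_le ht1)
  have hu := (u.pos' t).le
  rw [Real.rpow_natCast, Real.norm_of_nonneg (pow_nonneg (w.pos' t).le _),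
    Real.norm_of_nonneg hu, pow_succ]
  calc w t ^ c * w t ≤ C * ((t : ℝ) ^ n * u t) * w t :=
        mul_le_mul_of_nonneg_right ht (w.pos' t).le
    _ = C * (((t : ℝ) ^ n * w t) * u t) := by ring
    _ ≤ C * (w.assocSeq n * u t) := by gcongr
    _ = _ := by ring

/-- The common end of the arguments for (i): choosing the `j` adapted to `t` cancels `t^{nj}` and
leaves only a factor `t^n`. -/
theorem IsConvex.powPrec_of_pow_mul_le (hu : u.IsConvex) (hun : u.IsNormalized) {n c : ℕ}
    (hn : 0 < n) {C : ℝ} (hC : 0 ≤ C)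
    (h : ∀ (j : ℕ) (t : ℝ≥0), 1 ≤ t → (t : ℝ) ^ (n * j) * w t ^ c ≤ C * u.assocSeq (n * j)) :
    PowPrec u w := by
  refine powPrec_of_le_pow_mul (n := n) (c := c) hC ?_
  filter_upwards [Filter.eventually_ge_atTop 1] with t ht
  obtain ⟨j, hj⟩ := hu.exists_assocSeq_le hun hn ht
  have htj : 0 < (t : ℝ) ^ (n * j) := pow_pos (NNReal.coe_pos.2 (zero_lt_one.trans_le ht)) _
  refine le_of_mul_le_mul_left ((h j t ht).trans ((mul_le_mul_of_nonneg_left hj hC).trans_eq ?_))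
    htj
  ring

/-- The `c`-th power of `t^j w(t)` is `t^{cj} w(t)^c`, which explains the index `cj` and the root.
Only the converse needs `u` convex. -/
theorem powPrec_iff_assocSeq_le (hu : u.IsConvex) (hun : u.IsNormalized) (hwn : w.IsNormalized) :
    PowPrec u w ↔ ∃ c : ℕ, 0 < c ∧ ∃ A : ℝ, 1 ≤ A ∧
      ∀ j : ℕ, w.assocSeq j ≤ A * u.assocSeq (c * j) ^ (1 / (c : ℝ)) := by
  constructor
  · rw [powPrec_iff_exists_nat hwn]
    rintro ⟨c, hc, A, hA, h⟩
    have hc' : (0 : ℝ) < c := Nat.cast_pos.2 hc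
    have hA0 : 0 ≤ A := zero_le_one.trans hA
    refine ⟨c, hc, A ^ (1 / (c : ℝ)), Real.one_le_rpow hA (by positivity), fun j => ?_⟩
    refine w.assocSeq_le j fun t ht => ?_
    have hw0 : 0 ≤ (t : ℝ) ^ j * w t := mul_nonneg (pow_nonneg t.coe_nonneg _) (w.pos' t).le
    rw [← Real.mul_rpow hA0 (u.assocSeq_pos _).le, one_div,
      Real.le_rpow_inv_iff_of_pos hw0 (mul_nonneg hA0 (u.assocSeq_pos _).le) hc',
      Real.rpow_natCast, mul_pow, ← pow_mul, mul_comm j c]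
    calc (t : ℝ) ^ (c * j) * w t ^ c ≤ (t : ℝ) ^ (c * j) * (A * u t) := by gcongr; exact h t
      _ = A * ((t : ℝ) ^ (c * j) * u t) := by ring
      _ ≤ _ := by gcongr; exact u.pow_mul_le_assocSeq _ ht
  · rintro ⟨c, hc, A, hA, h⟩
    have hA0 : 0 ≤ A := zero_le_one.trans hA
    refine hu.powPrec_of_pow_mul_le hun hc (c := c) (C := A ^ c) (by positivity) fun j t ht => ?_
    have h1 := (w.pow_mul_le_assocSeq j (zero_lt_one.trans_le ht)).trans (h j)
    have h2 := pow_le_pow_left₀ (mul_nonneg (pow_nonneg t.coe_nonneg _) (w.pos' t).le) h1 c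
    rwa [mul_pow, ← pow_mul, mul_comm j c, mul_pow, one_div,
      Real.rpow_inv_natCast_pow (u.assocSeq_pos _).le hc.ne'] at h2

/-! ### The weight associated with the moment sequence -/

theorem seqWeight_assocSeq_le (v : Weight) {t : ℝ≥0} (ht : 0 < t) (j : ℕ) :
    seqWeight v.assocSeq t ≤ v.assocSeq j / (t : ℝ) ^ j := by
  have h := le_ciSup (v.bddAbove_assocFun ht) j
  have htj : 0 < (t : ℝ) ^ j := pow_pos (NNReal.coe_pos.2 ht) _
  rw [seqWeight, assocFun, if_neg ht.ne', ← Real.le_log_iff_exp_le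
    (div_pos (v.assocSeq_pos j) htj), ← inv_div, Real.log_inv]
  exact neg_le_neg h

theorem le_seqWeight_assocSeq (v : Weight) {t : ℝ≥0} (ht : 0 < t) :
    v t ≤ seqWeight v.assocSeq t := by
  rw [seqWeight, assocFun, if_neg ht.ne', ← Real.log_le_iff_le_exp (v.pos' t), le_neg]
  refine ciSup_le fun j => ?_
  have htj : 0 < (t : ℝ) ^ j := pow_pos (NNReal.coe_pos.2 ht) _
  rw [← Real.log_inv]
  refine Real.log_le_log (div_pos htj (v.assocSeq_pos j)) ?_
  rw [div_le_iff₀ (v.assocSeq_pos j), inv_mul_eq_div, le_div_iff₀ (v.pos' t)]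
  exact v.pow_mul_le_assocSeq j ht

theorem IsConvex.seqWeight_assocSeq_le_mul (hv : v.IsConvex) (hvn : v.IsNormalized) {t : ℝ≥0}
    (ht : 1 ≤ t) : seqWeight v.assocSeq t ≤ t * v t := by
  obtain ⟨j, hj⟩ := hv.exists_assocSeq_le hvn one_pos ht
  have ht0 : 0 < t := zero_lt_one.trans_le ht
  refine (v.seqWeight_assocSeq_le ht0 (1 * j)).trans ?_
  rw [div_le_iff₀ (pow_pos (NNReal.coe_pos.2 ht0) _)]
  exact hj.trans_eq (by ring)

/-- Each direction loses a power of `t` through `v_{M^v}(t) ≤ t v(t)`, for `w` in the forward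
direction and for `u` in the backward one. -/
theorem powPrec_iff_powPrec_seqWeight (hu : u.IsConvex) (hun : u.IsNormalized) (hw : w.IsConvex)
    (hwn : w.IsNormalized) :
    PowPrec u w ↔ PowPrec (seqWeight u.assocSeq) (seqWeight w.assocSeq) := by
  constructor
  · rw [powPrec_iff_exists_nat hwn]
    rintro ⟨c, hc, A, hA, h⟩
    -- Of the `c + 1` factors `v_{M^w}(t)`, `c` are bounded by `t w(t)`; the last is at most `M^w_c
    -- / t^c` and cancels the resulting `t^c`.
    refine ⟨(c + 1 : ℕ), by push_cast; linarith [c.cast_nonneg (α := ℝ)],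
      .of_bound (A * w.assocSeq c) ?_⟩
    filter_upwards [Filter.eventually_ge_atTop 1] with t ht
    have ht0 : 0 < t := zero_lt_one.trans_le ht
    have htc : 0 < (t : ℝ) ^ c := pow_pos (NNReal.coe_pos.2 ht0) _
    have hA0 : 0 ≤ A := zero_le_one.trans hA
    have hpos : ∀ M, 0 ≤ seqWeight M t := fun M => (Real.exp_pos _).le
    rw [Real.rpow_natCast, Real.norm_of_nonneg (pow_nonneg (hpos _) _),
      Real.norm_of_nonneg (hpos _), pow_succ]
    calc seqWeight w.assocSeq t ^ c * seqWeight w.assocSeq t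
        ≤ (t * w t) ^ c * (w.assocSeq c / (t : ℝ) ^ c) :=
          mul_le_mul (pow_le_pow_left₀ (hpos _) (hw.seqWeight_assocSeq_le_mul hwn ht) _)
            (w.seqWeight_assocSeq_le ht0 c) (hpos _)
            (pow_nonneg (mul_nonneg t.coe_nonneg (w.pos' t).le) _)
      _ = w.assocSeq c * w t ^ c := by rw [mul_pow]; field_simp
      _ ≤ w.assocSeq c * (A * seqWeight u.assocSeq t) :=
          mul_le_mul_of_nonneg_left ((h t).trans
            (mul_le_mul_of_nonneg_left (u.le_seqWeight_assocSeq ht0) hA0)) (w.assocSeq_pos c).le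
      _ = _ := by ring
  · rintro ⟨c, hc, h⟩
    obtain ⟨C, hC0, hC⟩ := h.exists_nonneg
    refine powPrec_of_le_pow_mul (n := 1) (c := ⌈c⌉₊) hC0 ?_
    filter_upwards [hC.bound, Filter.eventually_ge_atTop 1] with t ht ht1
    have ht0 : 0 < t := zero_lt_one.trans_le ht1
    have hpos : ∀ M, 0 ≤ seqWeight M t := fun M => (Real.exp_pos _).le
    rw [Real.norm_of_nonneg (Real.rpow_nonneg (hpos _) _), Real.norm_of_nonneg (hpos _)] at ht
    calc w t ^ ⌈c⌉₊ = w t ^ ((⌈c⌉₊ : ℕ) : ℝ) := (Real.rpow_natCast _ _).symm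
      _ ≤ w t ^ c := Real.rpow_le_rpow_of_exponent_ge (w.pos' t) (hwn.le_one t) (Nat.le_ceil c)
      _ ≤ seqWeight w.assocSeq t ^ c :=
        Real.rpow_le_rpow (w.pos' t).le (w.le_seqWeight_assocSeq ht0) (by linarith)
      _ ≤ C * seqWeight u.assocSeq t := ht
      _ ≤ C * (t ^ 1 * u t) := by
        rw [pow_one]
        exact mul_le_mul_of_nonneg_left (hu.seqWeight_assocSeq_le_mul hun ht1) hC0

end Weight

/-! ### Continuous inclusions of weighted spaces and their limits -/

/-- The continuous inclusion `H^∞_v ⊆ H^∞_w` for weights with `w ≤ C v`. -/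
noncomputable def HInf.inclusion {v w : Weight} (C : ℝ) (h : ∀ t, w t ≤ C * v t) :
    HInf v →L[ℂ] HInf w :=
  LinearMap.mkContinuous
    { toFun := fun f => ⟨f.1, f.2.1, C * ‖f‖, by
        rintro _ ⟨z, rfl⟩
        calc ‖f z‖ * w ‖z‖₊ ≤ ‖f z‖ * (C * v ‖z‖₊) :=
              mul_le_mul_of_nonneg_left (h _) (norm_nonneg _)
          _ = C * (‖f z‖ * v ‖z‖₊) := by ring
          _ ≤ C * ‖f‖ := mul_le_mul_of_nonneg_left (HInf.le_norm f z)
            (nonneg_of_mul_nonneg_left ((w.pos' 0).le.trans (h 0)) (v.pos' 0))⟩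
      map_add' := fun _ _ => rfl
      map_smul' := fun _ _ => rfl } C fun f => by
    refine ciSup_le fun z => ?_
    calc ‖f z‖ * w ‖z‖₊ ≤ ‖f z‖ * (C * v ‖z‖₊) :=
          mul_le_mul_of_nonneg_left (h _) (norm_nonneg _)
      _ = C * (‖f z‖ * v ‖z‖₊) := by ring
      _ ≤ C * ‖f‖ := mul_le_mul_of_nonneg_left (HInf.le_norm f z)
        (nonneg_of_mul_nonneg_left ((w.pos' 0).le.trans (h 0)) (v.pos' 0))

theorem hInfSubmodule_le {v w : Weight} (C : ℝ) (h : ∀ t, w t ≤ C * v t) :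
    hInfSubmodule v ≤ hInfSubmodule w := fun f hf =>
  (HInf.inclusion C h (⟨f, hf⟩ : hInfSubmodule v)).2

namespace HInd

variable {V : ℕ+ → Weight}

instance : IsTopologicalAddGroup (HInd V) := topologicalAddGroup_sInf fun _ h => h.2.1

instance : ContinuousSMul ℂ (HInd V) := continuousSMul_sInf fun _ h => h.2.2.1

instance : LocallyConvexSpace ℝ (HInd V) := LocallyConvexSpace.sInf fun _ h => h.2.2.2

theorem continuous_incl (n : ℕ+) : Continuous (incl n : HInf (V n) → HInd V) :=
  continuous_sInf_rng.2 fun _ h => h.1 n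

/-- A linear map out of the inductive limit is continuous as soon as its restrictions are. -/
theorem continuous_of_comp_incl {F : Type} [AddCommGroup F] [Module ℂ F] [TopologicalSpace F]
    [IsTopologicalAddGroup F] [ContinuousSMul ℂ F] [LocallyConvexSpace ℝ F] (g : HInd V →ₗ[ℂ] F)
    (hg : ∀ n, Continuous fun f : HInf (V n) => g (incl n f)) : Continuous g := by
  rw [continuous_iff_le_induced]
  -- The topology induced by `g` is itself one of those whose infimum defines the inductive limit
  -- topology.
  refine sInf_le ⟨fun n => continuous_induced_rng.2 (hg n), topologicalAddGroup_induced g,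
    continuousSMul_induced g, LocallyConvexSpace.induced (g.restrictScalars ℝ)⟩

theorem continuouslyIncluded {W : ℕ+ → Weight}
    (h : ∀ n, ∃ m, ∃ C : ℝ, ∀ t, W m t ≤ C * V n t) : ContinuouslyIncluded (HInd V) (HInd W) := by
  have hle : indSubmodule V ≤ indSubmodule W := iSup_le fun n => by
    obtain ⟨m, C, hC⟩ := h n
    exact (hInfSubmodule_le C hC).trans (le_iSup (fun k => hInfSubmodule (W k)) m)
  let g : HInd V →ₗ[ℂ] HInd W := Submodule.inclusion hle
  refine ⟨⟨g, continuous_of_comp_incl g fun n => ?_⟩, fun _ _ => rfl⟩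
  obtain ⟨m, C, hC⟩ := h n
  exact (continuous_incl m).comp (HInf.inclusion C hC).continuous

end HInd

namespace HProj

variable {V : ℕ+ → Weight}

theorem continuous_proj (n : ℕ+) : Continuous (proj n : HProj V → HInf (V n)) :=
  continuous_iInf_dom (i := n) continuous_induced_dom

theorem continuouslyIncluded {W : ℕ+ → Weight}
    (h : ∀ n, ∃ m, ∃ C : ℝ, ∀ t, W n t ≤ C * V m t) :
    ContinuouslyIncluded (HProj V) (HProj W) := by
  have hle : projSubmodule V ≤ projSubmodule W := le_iInf fun n => by
    obtain ⟨m, C, hC⟩ := h n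
    exact (iInf_le (fun k => hInfSubmodule (V k)) m).trans (hInfSubmodule_le C hC)
  let g : HProj V →ₗ[ℂ] HProj W := Submodule.inclusion hle
  refine ⟨⟨g, continuous_iInf_rng.2 fun n => continuous_induced_rng.2 ?_⟩, fun _ _ => rfl⟩
  obtain ⟨m, C, hC⟩ := h n
  exact (HInf.inclusion C hC).continuous.comp (continuous_proj m)

/-- Every neighbourhood of zero in the projective limit of a monotone system contains a ball of
one of the steps. -/
theorem exists_norm_lt_mem (hV : ∀ m n, m ≤ n → ∀ t, V m t ≤ V n t) {s : Set (HProj V)}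
    (hs : s ∈ 𝓝 (0 : HProj V)) :
    ∃ n, ∃ δ : ℝ, 0 < δ ∧ ∀ f : HProj V, ‖proj n f‖ < δ → f ∈ s := by
  have hb : ∀ n, (Filter.comap (proj n) (𝓝 (0 : HInf (V n)))).HasBasis (fun δ : ℝ => 0 < δ)
      fun δ => {f : HProj V | ‖proj n f‖ < δ} := fun n => by
    simpa [Set.preimage, mem_ball_zero_iff] using
      (Metric.nhds_basis_ball (x := (0 : HInf (V n)))).comap (proj n)
  rw [nhds_iInf] at hs
  have hs' : s ∈ ⨅ n, Filter.comap (proj n) (𝓝 (0 : HInf (V n))) := by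
    convert hs using 3 with n
    exact (@nhds_induced _ _ _ (proj n) (0 : HProj V)).symm
  have hdir : Directed (· ≥ ·) fun n => Filter.comap (proj (V := V) n) (𝓝 (0 : HInf (V n))) := by
    -- Norms increase with the index, so a ball of step `n` lies in the ball of the same radius of
    -- any step `m ≤ n`.
    refine Antitone.directed_ge fun m n hmn => ?_
    refine ((hb n).le_basis_iff (hb m)).2 fun δ hδ => ⟨δ, hδ, fun f hf => ?_⟩
    refine lt_of_le_of_lt (b := ‖proj n f‖) ?_ hf
    exact ciSup_le fun z => (mul_le_mul_of_nonneg_left (hV m n hmn _) (norm_nonneg _)).trans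
      (HInf.le_norm (proj n f) z)
  obtain ⟨n, hn⟩ := (Filter.mem_iInf_of_directed hdir s).1 hs'
  obtain ⟨δ, hδ, h⟩ := (hb n).mem_iff.1 hn
  exact ⟨n, δ, hδ, fun f hf => h hf⟩

/-- A continuous inclusion of projective limits is estimated by norms of the steps. -/
theorem exists_norm_le_of_continuouslyIncluded {W : ℕ+ → Weight}
    (hV : ∀ m n, m ≤ n → ∀ t, V m t ≤ V n t) (h : ContinuouslyIncluded (HProj V) (HProj W))
    (m : ℕ+) : ∃ n, ∃ C : ℝ, 1 ≤ C ∧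
      ∀ (f : HProj V) (z : ℂ), ‖f z‖ * W m ‖z‖₊ ≤ C * ‖proj n f‖ := by
  obtain ⟨ι, hι⟩ := h
  have hcont : Continuous fun f => proj m (ι f) := (continuous_proj m).comp ι.continuous
  have hzero : ‖proj m (ι 0)‖ < 1 := by
    have h0 : proj m (0 : HProj W) = 0 := rfl
    rw [map_zero, h0, norm_zero]
    exact one_pos
  have hnhds : {f : HProj V | ‖proj m (ι f)‖ < 1} ∈ 𝓝 (0 : HProj V) :=
    (isOpen_lt hcont.norm continuous_const).mem_nhds hzero
  obtain ⟨n, δ, hδ, hn⟩ := exists_norm_lt_mem hV hnhds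
  refine ⟨n, max 1 (2 / δ), le_max_left _ _, fun f z => ?_⟩
  refine le_trans ?_ (mul_le_mul_of_nonneg_right (le_max_right _ _) (norm_nonneg _))
  refine le_of_forall_pos_le_add fun ε hε => ?_
  -- Scaling by `a` brings `f` into the `δ`-ball, and `1/a = (2/δ)‖f‖ + ε`; the `ε` covers the case
  -- `‖f‖ = 0`.
  set a : ℝ := δ / (2 * (‖proj n f‖ + ε * δ / 2)) with ha
  have hN : 0 < ‖proj n f‖ + ε * δ / 2 := by positivity
  have ha0 : 0 < a := by positivity
  have hsmul : ‖proj n ((a : ℂ) • f)‖ = a * ‖proj n f‖ := by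
    have : proj n ((a : ℂ) • f) = (a : ℂ) • proj n f := rfl
    rw [this, norm_smul, Complex.norm_real, Real.norm_of_nonneg ha0.le]
  have hlt : ‖proj n ((a : ℂ) • f)‖ < δ := by
    rw [hsmul, ha, div_mul_eq_mul_div, div_lt_iff₀ (by positivity)]
    nlinarith [mul_pos hδ hN, mul_pos hε hδ, mul_pos (mul_pos hε hδ) hδ, norm_nonneg (proj n f)]
  have h1 : ‖proj m (ι ((a : ℂ) • f))‖ < 1 := hn _ hlt
  have h2 := (HInf.le_norm (proj m (ι ((a : ℂ) • f))) z).trans h1.le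
  have h3 : proj m (ι ((a : ℂ) • f)) z = a * f z := hι _ z
  rw [h3, norm_mul, Complex.norm_real, Real.norm_of_nonneg ha0.le, mul_assoc, mul_comm,
    ← le_div_iff₀ ha0] at h2
  refine h2.trans_eq ?_
  rw [ha]
  field_simp

end HProj

/-! ### Equality as two-sided continuous inclusion -/

theorem EqualAsTVS.continuouslyIncluded {E F : Type} [AddCommGroup E] [Module ℂ E]
    [TopologicalSpace E] [FunLike E ℂ ℂ] [AddCommGroup F] [Module ℂ F] [TopologicalSpace F]
    [FunLike F ℂ ℂ] (h : EqualAsTVS E F) : ContinuouslyIncluded E F :=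
  let ⟨e, he⟩ := h
  ⟨e, he⟩

theorem EqualAsTVS.symm {E F : Type} [AddCommGroup E] [Module ℂ E]
    [TopologicalSpace E] [FunLike E ℂ ℂ] [AddCommGroup F] [Module ℂ F] [TopologicalSpace F]
    [FunLike F ℂ ℂ] (h : EqualAsTVS E F) : EqualAsTVS F E :=
  let ⟨e, he⟩ := h
  ⟨e.symm, fun f z => by rw [← he, e.apply_symm_apply]⟩

theorem ContinuouslyIncluded.equalAsTVS {E F : Type} [AddCommGroup E] [Module ℂ E]
    [TopologicalSpace E] [FunLike E ℂ ℂ] [AddCommGroup F] [Module ℂ F] [TopologicalSpace F]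
    [FunLike F ℂ ℂ] (h : ContinuouslyIncluded E F) (h' : ContinuouslyIncluded F E) :
    EqualAsTVS E F :=
  let ⟨ι, hι⟩ := h
  let ⟨κ, hκ⟩ := h'
  ⟨.equivOfInverse ι κ (fun f => DFunLike.ext _ _ fun z => by rw [hκ, hι])
    (fun f => DFunLike.ext _ _ fun z => by rw [hι, hκ]), hι⟩

/-! ### Testing the inclusions on monomials and power series -/

namespace Weight

variable {u w : Weight}

theorem IsNormalized.pow_mul_le_assocSeq (hu : u.IsNormalized) (j : ℕ) (t : ℝ≥0) :
    (t : ℝ) ^ j * u t ≤ u.assocSeq j := by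
  rcases eq_or_ne t 0 with rfl | ht
  · have h := u.pow_mul_le_assocSeq j zero_lt_one
    rw [hu 1 le_rfl, NNReal.coe_one, one_pow, one_mul] at h
    exact (mul_le_one₀ (pow_le_one₀ le_rfl zero_le_one) (u.pos' 0).le (hu.le_one 0)).trans h
  · exact u.pow_mul_le_assocSeq j (pos_iff_ne_zero.2 ht)

/-- If `H^∞_u` is contained in the union of the spaces `H^∞_{w^n}`, then the normalized monomials
of `H^∞_u` are bounded in one of these spaces. -/
theorem exists_pow_mul_le_of_hInfSubmodule_subset (hun : u.IsNormalized) (hwn : w.IsNormalized)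
    (h : ∀ f ∈ hInfSubmodule u, ∃ n, f ∈ hInfSubmodule (w.expSystemLB n)) :
    ∃ n : ℕ, ∃ C : ℝ, 0 ≤ C ∧
      ∀ (j : ℕ) (t : ℝ≥0), (t : ℝ) ^ j * w t ^ n ≤ C * u.assocSeq j := by
  by_contra! hcon
  -- The factor `2^n` pays for the summable coefficients `2^{-n}`; the factor `n + 1` makes the
  -- humps unbounded.
  have hcon' : ∀ n : ℕ, ∃ (j : ℕ) (t : ℝ≥0),
      ((n + 1 : ℝ) * 2 ^ n) * u.assocSeq j < (t : ℝ) ^ j * w t ^ (n + 1) :=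
    fun n => hcon (n + 1) _ (by positivity)
  choose j t hjt using hcon'
  have hM : ∀ n, 0 < u.assocSeq (j n) := fun n => u.assocSeq_pos _
  set F : ℕ → ℂ → ℂ := fun n z => ((1 / 2 : ℝ) ^ n / u.assocSeq (j n) : ℝ) * z ^ j n with hF
  have hFnorm : ∀ n z, ‖F n z‖ = (1 / 2 : ℝ) ^ n / u.assocSeq (j n) * ‖z‖ ^ j n := fun n z => by
    have := hM n
    rw [hF, norm_mul, norm_pow, Complex.norm_real, Real.norm_of_nonneg (by positivity)]
  have hFle : ∀ n z, ‖F n z‖ ≤ (1 / 2 : ℝ) ^ n * (u ‖z‖₊)⁻¹ := fun n z => by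
    have h1 := hun.pow_mul_le_assocSeq (j n) ‖z‖₊
    rw [hFnorm, div_mul_eq_mul_div, mul_div_assoc]
    refine mul_le_mul_of_nonneg_left ?_ (by positivity)
    rw [div_le_iff₀ (hM n), inv_mul_eq_div, le_div_iff₀ (u.pos' _)]
    exact h1
  have hsum : ∀ a : ℝ, Summable fun n : ℕ => (1 / 2 : ℝ) ^ n * a := fun a =>
    summable_geometric_two.mul_right a
  have hFsum : ∀ z, Summable fun n => ‖F n z‖ := fun z =>
    Summable.of_nonneg_of_le (fun _ => norm_nonneg _) (fun n => hFle n z) (hsum _)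
  set f : ℂ → ℂ := fun z => ∑' n, F n z with hf
  have hdiff : Differentiable ℂ f := fun z => by
    -- On a ball, `1/u` is bounded by its value at the radius, so the series converges uniformly
    -- there.
    have hR : DifferentiableOn ℂ f (Metric.ball 0 (‖z‖₊ + 1 : ℝ≥0)) := by
      refine Complex.differentiableOn_tsum_of_summable_norm (hsum (u (‖z‖₊ + 1))⁻¹)
        (fun n => ?_) Metric.isOpen_ball fun n x hx => (hFle n x).trans ?_
      · exact ((differentiable_id.pow (j n)).const_mul _).differentiableOn
      · refine mul_le_mul_of_nonneg_left ?_ (by positivity)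
        rw [mem_ball_zero_iff] at hx
        exact inv_anti₀ (u.pos' _) (u.antitone' (by exact_mod_cast hx.le))
    refine hR.differentiableAt (Metric.isOpen_ball.mem_nhds ?_)
    simp
  have hmem : f ∈ hInfSubmodule u := by
    refine ⟨hdiff, 2, ?_⟩
    rintro _ ⟨z, rfl⟩
    have h1 : ‖f z‖ ≤ 2 * (u ‖z‖₊)⁻¹ := by
      rw [← tsum_geometric_two, ← tsum_mul_right]
      exact (norm_tsum_le_tsum_norm (hFsum z)).trans
        ((hFsum z).tsum_le_tsum (fun n => hFle n z) (hsum _))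
    rwa [← div_eq_mul_inv, le_div_iff₀ (u.pos' _)] at h1
  -- On the nonnegative real axis all terms are nonnegative, so `f(t_n)` is at least its `n`-th
  -- term.
  have hlow : ∀ n, (1 / 2 : ℝ) ^ n / u.assocSeq (j n) * (t n : ℝ) ^ j n ≤
      ‖f ((t n : ℝ) : ℂ)‖ := fun n => by
    have hreal : ∀ k, F k ((t n : ℝ) : ℂ) = ((‖F k ((t n : ℝ) : ℂ)‖ : ℝ) : ℂ) := fun k => by
      rw [hFnorm, Complex.norm_real, Real.norm_of_nonneg (t n).coe_nonneg]
      simp [hF]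
    have h1 : f ((t n : ℝ) : ℂ) = ((∑' k, ‖F k ((t n : ℝ) : ℂ)‖ : ℝ) : ℂ) := by
      rw [Complex.ofReal_tsum, hf]
      exact tsum_congr hreal
    rw [h1, Complex.norm_real, Real.norm_of_nonneg (tsum_nonneg fun _ => norm_nonneg _)]
    have h2 := (hFsum ((t n : ℝ) : ℂ)).le_tsum n fun _ _ => norm_nonneg _
    rwa [hFnorm n, Complex.norm_real, Real.norm_of_nonneg (t n).coe_nonneg] at h2
  obtain ⟨N, -, B, hB⟩ := h f hmem
  -- For this `n`, `|f(t_n)| w(t_n)^N > n + 1 > B`, since `w ≤ 1` and `N ≤ n + 1`.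
  obtain ⟨n, hn⟩ := exists_nat_ge (max B N)
  have hnB : B ≤ n := (le_max_left _ _).trans hn
  have hnN : (N : ℕ) ≤ n := by exact_mod_cast (le_max_right _ _).trans hn
  have h1 : ‖f ((t n : ℝ) : ℂ)‖ * w (t n) ^ ((N : ℕ) : ℝ) ≤ B := by
    have h2 := hB ⟨((t n : ℝ) : ℂ), rfl⟩
    have h3 : ‖((t n : ℝ) : ℂ)‖₊ = t n := NNReal.eq (by simp)
    simp only [h3] at h2
    exact h2
  rw [Real.rpow_natCast] at h1
  have h4 : w (t n) ^ (n + 1) ≤ w (t n) ^ (N : ℕ) :=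
    pow_le_pow_of_le_one (w.pos' _).le (hwn.le_one _) (by omega)
  have h5 : (n + 1 : ℝ) <
      (1 / 2 : ℝ) ^ n / u.assocSeq (j n) * (t n : ℝ) ^ j n * w (t n) ^ (n + 1) := by
    have h6 := hjt n
    have hMn := hM n
    rw [← lt_div_iff₀ hMn, ← lt_div_iff₀ (by positivity)] at h6
    refine h6.trans_eq ?_
    rw [one_div, inv_pow]
    field_simp
  have h7 := mul_le_mul (hlow n) h4 (pow_nonneg (w.pos' _).le _) (norm_nonneg _)
  linarith

/-- The `n`-th root of the bound for `M^u_{nj}`; it bounds the norm of `z^j` in the step `u^{1/n}`.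
-/
theorem IsNormalized.pow_mul_rpow_le (hu : u.IsNormalized) {n : ℕ} (hn : 0 < n) (j : ℕ)
    (t : ℝ≥0) :
    (t : ℝ) ^ j * u t ^ (1 / (n : ℝ)) ≤ u.assocSeq (n * j) ^ (1 / (n : ℝ)) := by
  have h := Real.rpow_le_rpow (mul_nonneg (pow_nonneg t.coe_nonneg _) (u.pos' t).le)
    (hu.pow_mul_le_assocSeq (n * j) t) (z := 1 / (n : ℝ)) (by positivity)
  rwa [Real.mul_rpow (pow_nonneg t.coe_nonneg _) (u.pos' t).le, mul_comm n j, pow_mul, one_div,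
    Real.pow_rpow_inv_natCast (pow_nonneg t.coe_nonneg _) hn.ne', mul_comm j n, ← one_div] at h

theorem IsNormalized.pow_mem_projSubmodule (hu : u.IsNormalized) (j : ℕ) :
    (fun z : ℂ => z ^ j) ∈ projSubmodule u.expSystemFrechet :=
  mem_projSubmodule_iff.2 fun n => ⟨differentiable_id.pow j, _, by
    rintro _ ⟨z, rfl⟩
    simp only [norm_pow]
    exact hu.pow_mul_rpow_le n.pos j ‖z‖₊⟩

/-- `u ≼^c w` gives the continuous inclusion of the inductive limits. -/
theorem continuouslyIncluded_hInd_of_powPrec (hwn : w.IsNormalized) (h : PowPrec u w) :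
    ContinuouslyIncluded (HInd u.expSystemLB) (HInd w.expSystemLB) := by
  obtain ⟨n, hn, A, -, h⟩ := (powPrec_iff_exists_nat hwn).1 h
  refine HInd.continuouslyIncluded fun k => ⟨⟨n, hn⟩ * k, A ^ (k : ℕ), fun t => ?_⟩
  change w t ^ ((n * k : ℕ) : ℝ) ≤ A ^ (k : ℕ) * u t ^ ((k : ℕ) : ℝ)
  rw [Real.rpow_natCast, Real.rpow_natCast, pow_mul, ← mul_pow]
  exact pow_le_pow_left₀ (pow_nonneg (w.pos' t).le _) (h t) _

theorem continuouslyIncluded_hProj_of_powPrec (hwn : w.IsNormalized) (h : PowPrec u w) :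
    ContinuouslyIncluded (HProj u.expSystemFrechet) (HProj w.expSystemFrechet) := by
  obtain ⟨n, hn, A, hA, h⟩ := (powPrec_iff_exists_nat hwn).1 h
  refine HProj.continuouslyIncluded fun k =>
    -- The exponent `1/(nk)` applied to `w^n ≤ A u` leaves `w^{1/k}` on the left.
    ⟨⟨n, hn⟩ * k, A ^ (1 / ((n * k : ℕ) : ℝ)), fun t => ?_⟩
  change w t ^ (1 / ((k : ℕ) : ℝ)) ≤ A ^ (1 / ((n * k : ℕ) : ℝ)) * u t ^ (1 / ((n * k : ℕ) : ℝ))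
  rw [← Real.mul_rpow (zero_le_one.trans hA) (u.pos' t).le]
  refine le_trans (le_of_eq ?_)
    (Real.rpow_le_rpow (pow_nonneg (w.pos' t).le _) (h t) (by positivity))
  rw [← Real.rpow_natCast, ← Real.rpow_mul (w.pos' t).le]
  congr 1
  have : (n : ℝ) ≠ 0 := by exact_mod_cast hn.ne'
  push_cast
  field_simp

/-- Only the inclusion of sets enters, and only on the first step `H^∞_u`. -/
theorem powPrec_of_continuouslyIncluded_hInd (hu : u.IsConvex) (hun : u.IsNormalized)
    (hwn : w.IsNormalized)
    (h : ContinuouslyIncluded (HInd u.expSystemLB) (HInd w.expSystemLB)) : PowPrec u w := by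
  obtain ⟨ι, hι⟩ := h
  obtain ⟨n, C, hC, h⟩ := exists_pow_mul_le_of_hInfSubmodule_subset hun hwn fun f hf => by
    have hf1 : f ∈ hInfSubmodule (u.expSystemLB 1) := by
      refine hInfSubmodule_le 1 (fun t => ?_) hf
      change u t ^ (((1 : ℕ+) : ℕ) : ℝ) ≤ 1 * u t
      simp
    have hmem : f ∈ indSubmodule w.expSystemLB := by
      let g : HInd u.expSystemLB := HInd.incl 1 (⟨f, hf1⟩ : hInfSubmodule (u.expSystemLB 1))
      have h1 : (ι g).1 = f := funext fun z => hι g z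
      exact h1 ▸ (ι g).2
    refine (mem_indSubmodule_iff fun m n hmn t => ?_).1 hmem
    exact rpow_le_rpow_of_isNormalized hwn _ _ (by exact_mod_cast hmn) t
  exact hu.powPrec_of_pow_mul_le hun one_pos hC fun j t _ => h (1 * j) t

/-- The norm estimate for the step `w^{1/1} = w`, applied to `z^j`, is the moment inequality (iv);
convexity of `u` then gives (i). -/
theorem powPrec_of_continuouslyIncluded_hProj (hu : u.IsConvex) (hun : u.IsNormalized)
    (hwn : w.IsNormalized)
    (h : ContinuouslyIncluded (HProj u.expSystemFrechet) (HProj w.expSystemFrechet)) :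
    PowPrec u w := by
  rw [powPrec_iff_assocSeq_le hu hun hwn]
  obtain ⟨n, C, hC, hn⟩ := HProj.exists_norm_le_of_continuouslyIncluded (fun m n hmn t =>
    rpow_le_rpow_of_isNormalized hun _ _
      (one_div_le_one_div_of_le (Nat.cast_pos.2 m.pos) (by exact_mod_cast hmn)) t) h 1
  refine ⟨n, n.pos, C, hC, fun j => w.assocSeq_le j fun t _ => ?_⟩
  let p : HProj u.expSystemFrechet := ⟨fun z : ℂ => z ^ j, hun.pow_mem_projSubmodule j⟩
  have h1 : ‖((t : ℝ) : ℂ) ^ j‖ * w ‖((t : ℝ) : ℂ)‖₊ ^ (1 / (((1 : ℕ+) : ℕ) : ℝ)) ≤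
      C * ‖HProj.proj n p‖ := hn p ((t : ℝ) : ℂ)
  have h2 : ‖((t : ℝ) : ℂ)‖₊ = t := NNReal.eq (by simp)
  have h3 : ‖((t : ℝ) : ℂ)‖ = t := by simp
  rw [norm_pow, h2, h3, PNat.one_coe, Nat.cast_one, div_one, Real.rpow_one] at h1
  refine h1.trans (mul_le_mul_of_nonneg_left ?_ (zero_le_one.trans hC))
  refine ciSup_le fun z => ?_
  change ‖z ^ j‖ * u ‖z‖₊ ^ (1 / ((n : ℕ) : ℝ)) ≤ _
  rw [norm_pow]
  exact hun.pow_mul_rpow_le n.pos j ‖z‖₊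

end Weight

/-! ### The equivalences -/

theorem mainTheorem7 (u w : Weight) (hun : u.IsNormalized) (hwn : w.IsNormalized)
    (huc : u.IsConvex) :
    List.TFAE
      [PowPrec u w,
        ContinuouslyIncluded (HInd u.expSystemLB) (HInd w.expSystemLB),
        ContinuouslyIncluded (HProj u.expSystemFrechet) (HProj w.expSystemFrechet)] ∧
    (w.IsConvex →
      List.TFAE
        [PowPrec u w,
          ContinuouslyIncluded (HInd u.expSystemLB) (HInd w.expSystemLB),
          ContinuouslyIncluded (HProj u.expSystemFrechet) (HProj w.expSystemFrechet),
          ∃ c : ℕ, 0 < c ∧ ∃ A : ℝ, 1 ≤ A ∧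
            ∀ j : ℕ, w.assocSeq j ≤ A * u.assocSeq (c * j) ^ (1 / (c : ℝ)),
          PowPrec (seqWeight u.assocSeq) (seqWeight w.assocSeq)]) ∧
    (w.IsConvex →
      List.TFAE
        [PowEquiv u w,
          EqualAsTVS (HInd u.expSystemLB) (HInd w.expSystemLB),
          EqualAsTVS (HProj u.expSystemFrechet) (HProj w.expSystemFrechet)]) := by
  refine ⟨?_, fun hwc => ?_, fun hwc => ?_⟩
  · tfae_have 1 → 2 := Weight.continuouslyIncluded_hInd_of_powPrec hwn
    tfae_have 2 → 1 := Weight.powPrec_of_continuouslyIncluded_hInd huc hun hwn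
    tfae_have 1 → 3 := Weight.continuouslyIncluded_hProj_of_powPrec hwn
    tfae_have 3 → 1 := Weight.powPrec_of_continuouslyIncluded_hProj huc hun hwn
    tfae_finish
  · tfae_have 1 → 2 := Weight.continuouslyIncluded_hInd_of_powPrec hwn
    tfae_have 2 → 1 := Weight.powPrec_of_continuouslyIncluded_hInd huc hun hwn
    tfae_have 1 → 3 := Weight.continuouslyIncluded_hProj_of_powPrec hwn
    tfae_have 3 → 1 := Weight.powPrec_of_continuouslyIncluded_hProj huc hun hwn
    tfae_have 1 ↔ 4 := Weight.powPrec_iff_assocSeq_le huc hun hwn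
    tfae_have 1 ↔ 5 := Weight.powPrec_iff_powPrec_seqWeight huc hun hwc hwn
    tfae_finish
  · tfae_have 1 → 2 := fun h =>
      (Weight.continuouslyIncluded_hInd_of_powPrec hwn h.1).equalAsTVS
        (Weight.continuouslyIncluded_hInd_of_powPrec hun h.2)
    tfae_have 2 → 1 := fun h =>
      ⟨Weight.powPrec_of_continuouslyIncluded_hInd huc hun hwn h.continuouslyIncluded,
        Weight.powPrec_of_continuouslyIncluded_hInd hwc hwn hun h.symm.continuouslyIncluded⟩
    tfae_have 1 → 3 := fun h =>
      (Weight.continuouslyIncluded_hProj_of_powPrec hwn h.1).equalAsTVS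
        (Weight.continuouslyIncluded_hProj_of_powPrec hun h.2)
    tfae_have 3 → 1 := fun h =>
      ⟨Weight.powPrec_of_continuouslyIncluded_hProj huc hun hwn h.continuouslyIncluded,
        Weight.powPrec_of_continuouslyIncluded_hProj hwc hwn hun h.symm.continuouslyIncluded⟩
    tfae_finish
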